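/- Consider the single secretary problem: an instance is a finite set $I$ of $n$ distinct real numbers, whose elements are revealed one by one in a uniformly random order. An online algorithm must, when a value is revealed, irrevocably either accept it and stop, or reject it. A (randomized) algorithm $a$ is described by arbitrary numbers $a_i(v_1,\dots,v_i)\in[0,1]$, for $i\ge 1$ and real $v_1,\dots,v_i$: $a_i(v_1,\dots,v_i)$ is the probability that it accepts $v_i$ at time $i$, conditioned on having seen $v_1,\dots,v_i$ in this order and on not having stopped before time $i$. Theorem. For every $\varepsilon>0$ and every $\rho>1$ there exist an integer $n\ge 1$, a finite set $W\subset\{1,\rho,\rho^2,\dots\}$, and a probability distribution $D$ on the (finite) collection of all $n$-element subsets of $W$ with the following property. For every algorithm $a$ (which may depend on $\varepsilon,\rho,n,W$ and $D$), if an instance $I$ is drawn from $D$, then the probability that $a$ accepts the maximum element of $I$ is at most $\frac1e+\varepsilon$, where the probability is over the random instance $I\sim D$, the uniformly random arrival order of its elements, and the internal randomness of $a$. -/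

import Mathlib

/-- A (possibly randomized) online algorithm for the single secretary problem. After the values
`v 0, …, v i` have been revealed, in this order, `a i v` is the probability that the algorithm stops
and accepts the current value `v i`, conditioned on having seen these values and on not having
stopped on any of `v 0, …, v (i - 1)`. -/
abbrev SecretaryAlgorithm : Type :=
  (i : ℕ) → (Fin (i + 1) → ℝ) → unitInterval

namespace SecretaryAlgorithm

/-- The conditional probability that `a` accepts the value arriving at time `i`, when the values
arrive in the order `v 0, …, v (n - 1)`; it is computed from `v 0, …, v i` only. -/
def acceptProb (a : SecretaryAlgorithm) {n : ℕ} (v : Fin n → ℝ) (i : Fin n) : ℝ :=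
  (a i fun j => v (Fin.castLE i.isLt j) : ℝ)

/-- The probability that `a` stops exactly at time `i`: it rejects all earlier values and then
accepts the value arriving at time `i`. -/
def stopProb (a : SecretaryAlgorithm) {n : ℕ} (v : Fin n → ℝ) (i : Fin n) : ℝ :=
  (∏ j ∈ Finset.univ.filter (· < i), (1 - a.acceptProb v j)) * a.acceptProb v i

/-- The probability, over the randomness of `a`, that `a` accepts the maximum value, when the values
arrive in the order `v 0, …, v (n - 1)`. -/
noncomputable def chooseMaxProb (a : SecretaryAlgorithm) {n : ℕ} (v : Fin n → ℝ) : ℝ :=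
  ∑ i : Fin n, if ∀ j, v j ≤ v i then a.stopProb v i else 0

/-- The probability, over the uniformly random arrival order and the randomness of `a`, that `a`
accepts the maximum of the instance `I`. -/
noncomputable def successProb (a : SecretaryAlgorithm) (I : Finset ℝ) : ℝ :=
  (∑ σ : Fin I.card ≃ I, a.chooseMaxProb fun i => (σ i : ℝ)) / (Fintype.card (Fin I.card ≃ I) : ℝ)

end SecretaryAlgorithm

open Finset

/-! Ranks 0, …, N-1 are mapped to values by an increasing map, and the random instance is made
nearly scale-free, so that values reveal nothing beyond relative order. Heuristically, a scale s
gets mass 1/(s+1) and distinct ranks below s are drawn uniformly. A prefix of n ≥ 1 distinct ranks,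
with M one more than the largest, then has weight ∑_{s ≥ M} 1/((s+1)(s)_n) = 1/(n (M)_n), where
(s)_n is the falling factorial; this is `prefixWeight`.

Whatever prefix of length n was seen, the next rank is a record with share at most 1/(n+1) and stays
below the top with share at most n/(n+1) (`sum_prefixWeight_snoc_above`,
`sum_prefixWeight_snoc_below`). So no algorithm beats the dynamic program of the classical problem,
whose value is at most 1/e + 1/n (`sum_le_of_potential`, `exists_potential`).

Truncation at N costs little: the mass starts at H_N = 1 + ⋯ + 1/N and is still at least H_N - n at
length n + 1 (`harmonicMass_sub_le_sum_prefixWeight`), while H_N diverges. Weights ignore order, so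
normalizing them gives a distribution on instances with uniform arrival order. -/

namespace Fin

/-! ### Splitting one coordinate off a tuple. -/

theorem insertNth_injective_iff {α : Type*} {n : ℕ} (p : Fin (n + 1)) (x : α) (u : Fin n → α) :
    Function.Injective (p.insertNth x u : Fin (n + 1) → α) ↔
      Function.Injective u ∧ ∀ j, u j ≠ x := by
  constructor
  · intro h
    refine ⟨fun i j hij => ?_, fun j hj => ?_⟩
    · have := @h (p.succAbove i) (p.succAbove j) (by simpa using hij)
      exact Fin.succAbove_right_injective this
    · have := @h (p.succAbove j) p (by simpa using hj)
      exact Fin.succAbove_ne p j this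
  · rintro ⟨h, hx⟩ i j
    refine Fin.succAboveCases p ?_ (fun i => ?_) i <;> refine Fin.succAboveCases p ?_ (fun j => ?_) j
    · simp
    · simpa using fun h => (hx j h.symm).elim
    · simpa using fun h => (hx i h).elim
    · simpa using fun hij => h hij

theorem sum_pi_insertNth {α M : Type*} [Fintype α] [AddCommMonoid M] {n : ℕ} (p : Fin (n + 1))
    (F : (Fin (n + 1) → α) → M) :
    ∑ v, F v = ∑ u : Fin n → α, ∑ x : α, F (p.insertNth x u) := by
  rw [Finset.sum_comm, ← Fintype.sum_prod_type']
  exact (Fintype.sum_equiv (Fin.insertNthEquiv (fun _ => α) p) _ _ fun _ => rfl).symm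

theorem sum_pi_snoc {α M : Type*} [Fintype α] [AddCommMonoid M] {n : ℕ}
    (F : (Fin (n + 1) → α) → M) :
    ∑ v, F v = ∑ u : Fin n → α, ∑ x : α, F (Fin.snoc u x) := by
  simp_rw [sum_pi_insertNth (Fin.last n) F, Fin.insertNth_last']

end Fin

/-! ### The scale-free weights on prefixes of ranks. -/

/-- One more than the largest entry of `v` (and `0` for the empty tuple). -/
def topRank {N n : ℕ} (v : Fin n → Fin N) : ℕ :=
  univ.sup fun j => (v j : ℕ) + 1

theorem topRank_le_iff {N n : ℕ} (v : Fin n → Fin N) (m : ℕ) :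
    topRank v ≤ m ↔ ∀ j, (v j : ℕ) < m := by
  simp [topRank]

theorem lt_topRank {N n : ℕ} (v : Fin n → Fin N) (j : Fin n) : (v j : ℕ) < topRank v :=
  (topRank_le_iff v _).1 le_rfl j

theorem topRank_insertNth {N n : ℕ} (p : Fin (n + 1)) (x : Fin N) (u : Fin n → Fin N) :
    topRank (p.insertNth x u : Fin (n + 1) → Fin N) = max ((x : ℕ) + 1) (topRank u) := by
  refine eq_of_forall_ge_iff fun m => ?_
  rw [topRank_le_iff, max_le_iff, topRank_le_iff, Fin.forall_iff_succAbove p]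
  simp

theorem topRank_snoc {N n : ℕ} (u : Fin n → Fin N) (x : Fin N) :
    topRank (Fin.snoc u x : Fin (n + 1) → Fin N) = max ((x : ℕ) + 1) (topRank u) := by
  rw [← Fin.insertNth_last', topRank_insertNth]

theorem le_topRank_of_injective {N n : ℕ} {v : Fin n → Fin N} (hv : Function.Injective v) :
    n ≤ topRank v := by
  have : (univ.image fun j => (v j : ℕ)) ⊆ range (topRank v) := by
    intro x hx
    obtain ⟨j, -, rfl⟩ := mem_image.1 hx
    exact mem_range.2 (lt_topRank v j)
  have h := card_le_card this
  rwa [card_image_of_injective univ (f := fun j => (v j : ℕ)) (Fin.val_injective.comp hv),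
    card_univ, Fintype.card_fin, card_range] at h

theorem topRank_eq_of_image_eq {N n : ℕ} {v v' : Fin n → Fin N}
    (h : univ.image v = univ.image v') : topRank v = topRank v' := by
  have key : ∀ w : Fin n → Fin N, topRank w = (univ.image w).sup fun x => (x : ℕ) + 1 := by
    intro w; rw [sup_image]; rfl
  rw [key, key, h]

/-- The total mass `1 + 1/2 + ⋯ + 1/N`. -/
noncomputable def harmonicMass (N : ℕ) : ℝ :=
  ∑ x ∈ range N, 1 / ((x : ℝ) + 1)

theorem harmonicMass_nonneg (N : ℕ) : 0 ≤ harmonicMass N :=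
  sum_nonneg fun _ _ => by positivity

/-- The weight of the prefix `v`: the limiting unnormalized probability that the first `n` ranks
revealed are `v 0, …, v (n - 1)`. -/
noncomputable def prefixWeight {N n : ℕ} (v : Fin n → Fin N) : ℝ :=
  if Function.Injective v then
    if n = 0 then harmonicMass N else ((n : ℝ) * ((topRank v).descFactorial n : ℝ))⁻¹
  else 0

theorem prefixWeight_nonneg {N n : ℕ} (v : Fin n → Fin N) : 0 ≤ prefixWeight v := by
  unfold prefixWeight
  split_ifs
  · exact harmonicMass_nonneg N
  · positivity
  · exact le_rfl

theorem prefixWeight_eq_of_image_eq {N n : ℕ} {v v' : Fin n → Fin N}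
    (h : univ.image v = univ.image v') : prefixWeight v = prefixWeight v' := by
  have hinj : ∀ w : Fin n → Fin N, Function.Injective w ↔ (univ.image w).card = n := by
    intro w
    have := card_image_iff (s := univ) (f := w)
    rw [card_univ, Fintype.card_fin, coe_univ, Set.injOn_univ] at this
    exact this.symm
  unfold prefixWeight
  simp only [hinj, h, topRank_eq_of_image_eq h]

theorem prefixWeight_snoc_of_injective {N n : ℕ} {u : Fin n → Fin N} (hu : Function.Injective u)
    (x : Fin N) :
    prefixWeight (Fin.snoc u x : Fin (n + 1) → Fin N) =
      if ∀ j, u j ≠ x then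
        (((n : ℝ) + 1) * ((max ((x : ℕ) + 1) (topRank u)).descFactorial (n + 1) : ℝ))⁻¹
      else 0 := by
  simp [prefixWeight, Fin.snoc_injective_iff, hu, topRank_snoc]

theorem prefixWeight_snoc_of_not_injective {N n : ℕ} {u : Fin n → Fin N}
    (hu : ¬ Function.Injective u) (x : Fin N) :
    prefixWeight (Fin.snoc u x : Fin (n + 1) → Fin N) = 0 := by
  simp [prefixWeight, Fin.snoc_injective_iff, hu]

/-- With M = `topRank u`, at most M - n ranks below M are free, each giving weight
1/((n+1)(M)_{n+1}), and (M)_{n+1} = (M-n)(M)_n. -/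
theorem sum_prefixWeight_snoc_below {N n : ℕ} (u : Fin n → Fin N) :
    ∑ x : Fin N, (if (x : ℕ) < topRank u then prefixWeight (Fin.snoc u x : Fin (n + 1) → Fin N)
      else 0) ≤ (n : ℝ) / (n + 1) * prefixWeight u := by
  by_cases hu : Function.Injective u
  swap
  · simp only [prefixWeight_snoc_of_not_injective hu, ite_self, sum_const_zero]
    exact mul_nonneg (by positivity) (prefixWeight_nonneg u)
  rcases Nat.eq_zero_or_pos n with rfl | hn
  · have : topRank u = 0 := by simp [topRank]
    simp [this]
  set m := topRank u with hm
  set A : Finset (Fin N) := univ.filter fun x => (x : ℕ) < m ∧ ∀ j, u j ≠ x with hA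
  have hcard : A.card ≤ m - n := by
    have hsub : (A.image Fin.val) ⊆ range m \ univ.image (fun j => (u j : ℕ)) := by
      intro y hy
      obtain ⟨x, hx, rfl⟩ := mem_image.1 hy
      obtain ⟨hx1, hx2⟩ := (mem_filter.1 hx).2
      simp only [mem_sdiff, mem_range, mem_image, mem_univ, true_and, not_exists]
      exact ⟨hx1, fun j hj => hx2 j (Fin.val_injective hj)⟩
    have h1 := card_le_card hsub
    rw [card_image_of_injective _ Fin.val_injective, card_sdiff_of_subset, card_range,
      card_image_of_injective univ (f := fun j => (u j : ℕ)) (Fin.val_injective.comp hu),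
      card_univ, Fintype.card_fin] at h1
    · exact h1
    · intro y hy
      obtain ⟨j, -, rfl⟩ := mem_image.1 hy
      exact mem_range.2 (lt_topRank u j)
  have hsum : ∑ x : Fin N, (if (x : ℕ) < m then
      prefixWeight (Fin.snoc u x : Fin (n + 1) → Fin N) else 0) =
      A.card * (((n : ℝ) + 1) * (m.descFactorial (n + 1) : ℝ))⁻¹ := by
    rw [← nsmul_eq_mul, ← sum_const, hA, sum_filter]
    refine sum_congr rfl fun x _ => ?_
    rw [prefixWeight_snoc_of_injective hu, ite_and]
    split_ifs with h1 h2
    · rw [← hm, max_eq_right h1]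
    · rfl
    · rfl
  have hw : prefixWeight u = ((n : ℝ) * (m.descFactorial n : ℝ))⁻¹ := by
    simp [prefixWeight, hu, hn.ne', hm]
  rw [hsum, hw, Nat.descFactorial_succ]
  have hmn : n ≤ m := le_topRank_of_injective hu
  have hD : (0 : ℝ) < m.descFactorial n := by
    exact_mod_cast Nat.descFactorial_pos.2 hmn
  have hn' : (0 : ℝ) < n := by exact_mod_cast hn
  have hR : (n : ℝ) / (n + 1) * ((n : ℝ) * (m.descFactorial n : ℝ))⁻¹
      = (((n : ℝ) + 1) * (m.descFactorial n : ℝ))⁻¹ := by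
    field_simp
  rw [hR]
  -- If m = n, no rank is free and the factor m - n cannot be cancelled.
  rcases Nat.eq_zero_or_pos (m - n) with h0 | hpos
  · have : A.card = 0 := by omega
    rw [this]; simp; positivity
  · have hpos' : (0 : ℝ) < ((m - n : ℕ) : ℝ) := by exact_mod_cast hpos
    calc (A.card : ℝ) * (((n : ℝ) + 1) * (((m - n) * m.descFactorial n : ℕ) : ℝ))⁻¹
        ≤ ((m - n : ℕ) : ℝ) * (((n : ℝ) + 1) * (((m - n) * m.descFactorial n : ℕ) : ℝ))⁻¹ := by
          gcongr
      _ = (((n : ℝ) + 1) * (m.descFactorial n : ℝ))⁻¹ := by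
          push_cast
          field_simp

theorem sum_inv_descFactorial_le {n m : ℕ} (hn : 0 < n) (hmn : n ≤ m) (N : ℕ) :
    ∑ x ∈ range N, (if m ≤ x then ((x + 1).descFactorial (n + 1) : ℝ)⁻¹ else 0) ≤
      ((n : ℝ) * (m.descFactorial n : ℝ))⁻¹ := by
  have hn' : (0 : ℝ) < n := by exact_mod_cast hn
  -- Telescoping via 1/(x+1)_{n+1} = (1/n)(1/(x)_n - 1/(x+1)_n); the maximum also covers N < m,
  -- where the sum is empty.
  have key : ∑ x ∈ range N, (if m ≤ x then ((x + 1).descFactorial (n + 1) : ℝ)⁻¹ else 0) =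
      (n : ℝ)⁻¹ * ((m.descFactorial n : ℝ)⁻¹ - ((max N m).descFactorial n : ℝ)⁻¹) := by
    induction N with
    | zero => simp
    | succ N ih =>
      rw [sum_range_succ, ih]
      by_cases h : m ≤ N
      · rw [if_pos h, max_eq_left h, max_eq_left (by omega)]
        have h1 : ((N + 1).descFactorial (n + 1) : ℝ) = (N + 1) * (N.descFactorial n : ℝ) := by
          rw [Nat.succ_descFactorial_succ]; push_cast; ring
        have h2 : ((N : ℝ) + 1 - n) * ((N + 1).descFactorial n : ℝ) =
            (N + 1) * (N.descFactorial n : ℝ) := by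
          rw [← h1, Nat.descFactorial_succ, Nat.cast_mul, Nat.cast_sub (by omega)]
          push_cast; ring
        have p1 : (0 : ℝ) < N.descFactorial n := by
          exact_mod_cast Nat.descFactorial_pos.2 (by omega)
        have p2 : (0 : ℝ) < (N + 1).descFactorial n := by
          exact_mod_cast Nat.descFactorial_pos.2 (by omega)
        have p3 : (0 : ℝ) < (N : ℝ) + 1 := by positivity
        have h3 : ((N + 1).descFactorial (n + 1) : ℝ)⁻¹ =
            (n : ℝ)⁻¹ * ((N.descFactorial n : ℝ)⁻¹ - ((N + 1).descFactorial n : ℝ)⁻¹) := by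
          rw [h1]
          field_simp
          linear_combination -h2
        rw [h3]; ring
      · rw [if_neg h, max_eq_right (by omega), max_eq_right (by omega), add_zero]
  rw [key, mul_inv]
  have : (0 : ℝ) ≤ ((max N m).descFactorial n : ℝ)⁻¹ := by positivity
  gcongr
  linarith

theorem sum_prefixWeight_snoc_above {N n : ℕ} (u : Fin n → Fin N) :
    ∑ x : Fin N, (if topRank u ≤ (x : ℕ) then prefixWeight (Fin.snoc u x : Fin (n + 1) → Fin N)
      else 0) ≤ 1 / ((n : ℝ) + 1) * prefixWeight u := by
  by_cases hu : Function.Injective u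
  swap
  · simp only [prefixWeight_snoc_of_not_injective hu, ite_self, sum_const_zero]
    exact mul_nonneg (by positivity) (prefixWeight_nonneg u)
  set m := topRank u with hm
  have hsum : ∑ x : Fin N, (if m ≤ (x : ℕ) then
      prefixWeight (Fin.snoc u x : Fin (n + 1) → Fin N) else 0) =
      1 / ((n : ℝ) + 1) *
        ∑ x ∈ range N, (if m ≤ x then ((x + 1).descFactorial (n + 1) : ℝ)⁻¹ else 0) := by
    rw [← Fin.sum_univ_eq_sum_range
      (fun x => if m ≤ x then ((x + 1).descFactorial (n + 1) : ℝ)⁻¹ else 0), mul_sum]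
    refine sum_congr rfl fun x _ => ?_
    rw [prefixWeight_snoc_of_injective hu]
    split_ifs with h1 h2
    · rw [← hm, max_eq_left (by omega), mul_inv, one_div]
    · push Not at h2
      obtain ⟨j, hj⟩ := h2
      have := lt_topRank u j
      rw [hj] at this
      omega
    · rw [mul_zero]
  rw [hsum]
  gcongr
  -- For the empty prefix the untruncated series diverges; its weight H_N is exactly the mass of all
  -- first ranks below N.
  rcases Nat.eq_zero_or_pos n with rfl | hn
  · have hm0 : m = 0 := by simp [hm, topRank]
    simp [prefixWeight, hu, hm0, harmonicMass]
  · have hw : prefixWeight u = ((n : ℝ) * (m.descFactorial n : ℝ))⁻¹ := by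
      simp [prefixWeight, hu, hn.ne', hm]
    rw [hw]
    exact sum_inv_descFactorial_le hn (le_topRank_of_injective hu) N

theorem sum_prefixWeight_snoc {N n : ℕ} (u : Fin n → Fin N) :
    ∑ x : Fin N, prefixWeight (Fin.snoc u x : Fin (n + 1) → Fin N) ≤ prefixWeight u := by
  have h1 := sum_prefixWeight_snoc_below u
  have h2 := sum_prefixWeight_snoc_above u
  have h3 := add_le_add h1 h2
  rw [← sum_add_distrib] at h3
  have h4 : (n : ℝ) / (n + 1) * prefixWeight u + 1 / (n + 1) * prefixWeight u = prefixWeight u := by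
    field_simp
  rw [h4] at h3
  refine le_trans (le_of_eq (sum_congr rfl fun x _ => ?_)) h3
  by_cases h : (x : ℕ) < topRank u
  · rw [if_pos h, if_neg (by omega), add_zero]
  · rw [if_neg h, if_pos (by omega), zero_add]

/-- Fix the position of the maximum and its rank x ≥ n: the (x)_n fillings by smaller ranks
contribute 1/((n+1)(x+1)) in total. Summing over the n + 1 positions leaves H_N without its terms x
< n, each at most 1. -/
theorem harmonicMass_sub_le_sum_prefixWeight (N n : ℕ) :
    harmonicMass N - n ≤ ∑ v : Fin (n + 1) → Fin N, prefixWeight v := by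
  have hcount : ∀ x : Fin N, x.val.descFactorial n ≤
      (univ.filter fun u : Fin n → Fin N =>
        Function.Injective u ∧ ∀ j, (u j : ℕ) < x).card := by
    intro x
    have h := Fintype.card_embedding_eq (α := Fin n) (β := Fin x)
    rw [Fintype.card_fin, Fintype.card_fin] at h
    rw [← h, ← card_univ]
    refine card_le_card_of_injOn (fun e j => Fin.castLE x.isLt.le (e j)) ?_ ?_
    · intro e _
      simp only [coe_filter, mem_univ, true_and, Set.mem_ofPred_eq]
      exact ⟨(Fin.castLE_injective _).comp e.injective, fun j => (e j).isLt⟩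
    · intro e _ e' _ he
      ext j
      exact congrArg (fun f : Fin n → Fin N => (f j : ℕ)) he
  have hone : ∀ p : Fin (n + 1), (harmonicMass N - n) / (n + 1) ≤
      ∑ v : Fin (n + 1) → Fin N, if ∀ j, v (p.succAbove j) < v p then prefixWeight v else 0 := by
    intro p
    rw [Fin.sum_pi_insertNth p, sum_comm]
    have hx : ∀ x : Fin N, (if n ≤ (x : ℕ) then 1 / ((x : ℝ) + 1) else 0) / (n + 1) ≤
        ∑ u : Fin n → Fin N, if ∀ j, (p.insertNth x u : Fin (n + 1) → Fin N) (p.succAbove j) <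
          (p.insertNth x u : Fin (n + 1) → Fin N) p
          then prefixWeight (p.insertNth x u : Fin (n + 1) → Fin N) else 0 := by
      intro x
      have e : ∀ u : Fin n → Fin N,
          (if ∀ j, (p.insertNth x u : Fin (n + 1) → Fin N) (p.succAbove j) <
          (p.insertNth x u : Fin (n + 1) → Fin N) p
          then prefixWeight (p.insertNth x u : Fin (n + 1) → Fin N) else 0) =
          if Function.Injective u ∧ ∀ j, (u j : ℕ) < x then
            (((n : ℝ) + 1) * (((x : ℕ) + 1).descFactorial (n + 1) : ℝ))⁻¹ else 0 := by
        intro u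
        simp only [Fin.insertNth_apply_succAbove, Fin.insertNth_apply_same]
        by_cases h : ∀ j, u j < x
        · have h' : ∀ j, (u j : ℕ) < x := h
          have hne : ∀ j, u j ≠ x := fun j => (h j).ne
          have ht : topRank u ≤ (x : ℕ) + 1 := (topRank_le_iff _ _).2 fun j => by
            have := h' j; omega
          have hi : (Function.Injective u ∧ ∀ j, u j ≠ x) ↔ Function.Injective u :=
            and_iff_left hne
          simp only [h, h', prefixWeight, Fin.insertNth_injective_iff, hi, topRank_insertNth,
            max_eq_left ht]
          simp
        · have h' : ¬ ∀ j, (u j : ℕ) < x := h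
          rw [if_neg h, if_neg fun hc => h' hc.2]
      rw [sum_congr rfl fun u _ => e u, ← sum_filter, sum_const, nsmul_eq_mul]
      split_ifs with hnx
      · have hD : (0 : ℝ) < (x : ℕ).descFactorial n := by
          exact_mod_cast Nat.descFactorial_pos.2 hnx
        calc 1 / (((x : ℕ) : ℝ) + 1) / (n + 1)
            = ((x : ℕ).descFactorial n : ℝ) *
              (((n : ℝ) + 1) * (((x : ℕ) + 1).descFactorial (n + 1) : ℝ))⁻¹ := by
              rw [Nat.succ_descFactorial_succ]
              push_cast
              field_simp
          _ ≤ _ := by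
              gcongr
              exact hcount x
      · rw [zero_div]; positivity
    refine le_trans ?_ (sum_le_sum fun x _ => hx x)
    rw [← sum_div, Fin.sum_univ_eq_sum_range
      (fun x => if n ≤ x then 1 / ((x : ℝ) + 1) else 0)]
    gcongr
    have hs : ∑ x ∈ range N, (if x < n then (1 : ℝ) else 0) ≤ n := by
      rw [← sum_filter, sum_const, nsmul_eq_mul, mul_one]
      have : (range N).filter (· < n) ⊆ range n := fun y hy => mem_range.2 (mem_filter.1 hy).2
      exact_mod_cast (card_le_card this).trans_eq (card_range n)
    have : harmonicMass N ≤ ∑ x ∈ range N, (if n ≤ x then 1 / ((x : ℝ) + 1) else 0) +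
        ∑ x ∈ range N, (if x < n then (1 : ℝ) else 0) := by
      rw [← sum_add_distrib]
      refine sum_le_sum fun x _ => ?_
      by_cases h : n ≤ x
      · rw [if_pos h, if_neg (by omega), add_zero]
      · rw [if_neg h, if_pos (by omega), zero_add, div_le_one (by positivity)]
        have : (0 : ℝ) ≤ x := by positivity
        linarith
    linarith
  calc harmonicMass N - n = ∑ p : Fin (n + 1), (harmonicMass N - n) / (n + 1) := by
        rw [sum_const, card_univ, Fintype.card_fin, nsmul_eq_mul]
        push_cast
        field_simp
    _ ≤ ∑ p : Fin (n + 1), ∑ v : Fin (n + 1) → Fin N,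
        (if ∀ j, v (p.succAbove j) < v p then prefixWeight v else 0) :=
        sum_le_sum fun p _ => hone p
    _ = ∑ v : Fin (n + 1) → Fin N, ∑ p : Fin (n + 1),
        (if ∀ j, v (p.succAbove j) < v p then prefixWeight v else 0) := sum_comm
    _ ≤ ∑ v : Fin (n + 1) → Fin N, prefixWeight v := by
        refine sum_le_sum fun v _ => ?_
        rw [← sum_filter, sum_const, nsmul_eq_mul]
        have : (univ.filter fun p => ∀ j, v (p.succAbove j) < v p).card ≤ 1 := by
          refine card_le_one.2 fun p hp q hq => ?_
          by_contra hne
          obtain ⟨j, hj⟩ := Fin.exists_succAbove_eq (Ne.symm hne)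
          obtain ⟨k, hk⟩ := Fin.exists_succAbove_eq hne
          have h1 := (mem_filter.1 hp).2 j
          have h2 := (mem_filter.1 hq).2 k
          rw [hj] at h1
          rw [hk] at h2
          exact lt_asymm h1 h2
        have h' : ((univ.filter fun p => ∀ j, v (p.succAbove j) < v p).card : ℝ) ≤ 1 := by
          exact_mod_cast this
        exact mul_le_of_le_one_left (prefixWeight_nonneg v) h'

/-! ### The dynamic program of the classical secretary problem. -/

/-- `T k` is the mass still unstopped, `q k` the mass stopped on a record at time k, and `V k`
bounds the future reward per unit of `T k`. The quantity "reward so far plus `V m * T m`" never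
increases. -/
theorem sum_le_of_potential {n : ℕ} (T q V : ℕ → ℝ) (hT : ∀ k, 0 ≤ T k) (hq : ∀ k, 0 ≤ q k)
    (hstep : ∀ k, T (k + 1) ≤ T k - q k) (hrec : ∀ k : ℕ, ((k : ℝ) + 1) * q k ≤ T k)
    (hV : ∀ i ≤ n, 0 ≤ V i) (hmono : ∀ i < n, V (i + 1) ≤ V i)
    (hdec : ∀ i < n, V (i + 1) * (1 - 1 / ((i : ℝ) + 1)) + 1 / n ≤ V i) :
    ∑ i ∈ range n, ((i : ℝ) + 1) / n * q i ≤ V 0 * T 0 := by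
  have key : ∀ m ≤ n, ∑ i ∈ range m, ((i : ℝ) + 1) / n * q i + V m * T m ≤ V 0 * T 0 := by
    intro m
    induction m with
    | zero => simp
    | succ m ih =>
      intro hm
      refine le_trans ?_ (ih (by omega))
      rw [sum_range_succ, add_assoc]
      refine add_le_add le_rfl ?_
      have hm0 : (0 : ℝ) < (m : ℝ) + 1 := by positivity
      have h1 : V (m + 1) * T (m + 1) ≤ V (m + 1) * (T m - q m) :=
        mul_le_mul_of_nonneg_left (hstep m) (hV _ hm)
      -- The bound is linear in `q m`, so only the extremes matter: stop on no record (`hmono`) or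
      -- on every record (`hdec`).
      rcases le_total (((m : ℝ) + 1) / n) (V (m + 1)) with h | h
      · have h2 := mul_le_mul_of_nonneg_right h (hq m)
        have h3 := mul_le_mul_of_nonneg_right (hmono m (by omega)) (hT m)
        linarith
      · have h2 : q m ≤ T m / ((m : ℝ) + 1) := by
          rw [le_div_iff₀ hm0]; linarith [hrec m]
        have h3 := mul_le_mul_of_nonneg_left h2 (sub_nonneg.2 h)
        have h4 := mul_le_mul_of_nonneg_right (hdec m (by omega)) (hT m)
        have h5 : (((m : ℝ) + 1) / n - V (m + 1)) * (T m / ((m : ℝ) + 1)) + V (m + 1) * T m =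
            (V (m + 1) * (1 - 1 / ((m : ℝ) + 1)) + 1 / n) * T m := by
          field_simp
          ring
        linarith
  have := key n le_rfl
  have h0 := mul_nonneg (hV n le_rfl) (hT n)
  linarith

theorem exists_potential {n : ℕ} (hn : 2 ≤ n) :
    ∃ V : ℕ → ℝ, V 0 = 1 / Real.exp 1 + 1 / n ∧ (∀ i ≤ n, 0 ≤ V i) ∧
      (∀ i < n, V (i + 1) ≤ V i) ∧
      ∀ i < n, V (i + 1) * (1 - 1 / ((i : ℝ) + 1)) + 1 / n ≤ V i := by
  set b : ℝ := (n : ℝ) - 1 with hb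
  set E : ℝ := Real.exp 1 with hE
  have hE0 : 0 < E := Real.exp_pos 1
  have hn2 : (2 : ℝ) ≤ n := by exact_mod_cast hn
  have hn0 : (0 : ℝ) < n := by linarith
  have hb0 : 0 < b := by rw [hb]; linarith
  have hbE : 0 < b / E := by positivity
  have hlog : ∀ y : ℝ, b / E ≤ y → Real.log (b / y) ≤ 1 := by
    intro y hy
    have hy0 : 0 < y := lt_of_lt_of_le hbE hy
    rw [Real.log_le_iff_le_exp (by positivity), div_le_iff₀ hy0]
    rw [div_le_iff₀ hE0] at hy
    linarith
  have hmul : ∀ y : ℝ, 0 < y → y * Real.log (b / y) ≤ b / E := by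
    intro y hy
    have hby : 0 < b / y := by positivity
    have h := Real.add_one_le_exp (Real.log (b / y) - 1)
    rw [Real.exp_sub, Real.exp_log hby] at h
    have h2 : Real.log (b / y) ≤ b / y / E := by linarith
    calc y * Real.log (b / y) ≤ y * (b / y / E) := by gcongr
      _ = b / E := by field_simp
  have hpos : ∀ y : ℝ, 0 < y → y ≤ b → 0 ≤ Real.log (b / y) := fun y hy hyb =>
    Real.log_nonneg ((one_le_div hy).2 hyb)
  have hC : (b / E + 1) / n ≤ 1 / E + 1 / n := by
    have h : b / E / n ≤ 1 / E := by
      rw [div_right_comm]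
      gcongr
      rw [div_le_one hn0, hb]
      linarith
    rw [add_div]
    linarith
  -- Past the threshold the classical continuation value is (i/n) ∑_{j=i}^{n-1} 1/j, bounded here by
  -- the integral of 1/x from i-1 to n-1. Before it, a constant bounds the optimum.
  set V : ℕ → ℝ := fun i => if (i : ℝ) - 1 < b / E then 1 / E + 1 / n else
    (i : ℝ) / n * Real.log (b / ((i : ℝ) - 1)) with hVdef
  have hboth : ∀ i < n, V (i + 1) ≤ V i ∧
      V (i + 1) * (1 - 1 / ((i : ℝ) + 1)) + 1 / n ≤ V i := by
    intro i hi
    have hi0 : (0 : ℝ) ≤ i := by positivity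
    have hin : (i : ℝ) ≤ b := by
      have : (i : ℝ) + 1 ≤ n := by exact_mod_cast hi
      rw [hb]; linarith
    simp only [hVdef, Nat.cast_add, Nat.cast_one, add_sub_cancel_right]
    by_cases hA : (i : ℝ) < b / E
    · rw [if_pos hA, if_pos (by linarith)]
      refine ⟨le_rfl, ?_⟩
      have h1 : ((i : ℝ) + 1) / n ≤ 1 / E + 1 / n := le_trans (by gcongr) hC
      have h2 : 1 / (n : ℝ) ≤ (1 / E + 1 / n) * (1 / ((i : ℝ) + 1)) := by
        rw [mul_one_div, le_div_iff₀ (by positivity), one_div_mul_eq_div]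
        exact h1
      linarith
    · rw [if_neg hA]
      have hA' := not_lt.1 hA
      have hipos : (0 : ℝ) < i := lt_of_lt_of_le hbE hA'
      have hL1 := hlog i hA'
      have hLb := hmul i hipos
      set L := Real.log (b / i) with hL
      have e1 : ((i : ℝ) + 1) / n * L = (i * L + L) / n := by ring
      have e2 : ((i : ℝ) + 1) / n * L * (1 - 1 / ((i : ℝ) + 1)) + 1 / n = (i * L + 1) / n := by
        field_simp
        ring
      rw [e2, e1]
      suffices h : (i * L + 1) / n ≤ (if (i : ℝ) - 1 < b / E then 1 / E + 1 / n else
          (i : ℝ) / n * Real.log (b / ((i : ℝ) - 1))) from ⟨le_trans (by gcongr) h, h⟩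
      by_cases hB : (i : ℝ) - 1 < b / E
      · rw [if_pos hB]
        exact le_trans (by gcongr) hC
      · rw [if_neg hB]
        have hy : 0 < (i : ℝ) - 1 := lt_of_lt_of_le hbE (not_lt.1 hB)
        have h := Real.one_sub_inv_le_log_of_pos (x := (i : ℝ) / (i - 1)) (by positivity)
        have h2 : Real.log (b / ((i : ℝ) - 1)) = L + Real.log ((i : ℝ) / (i - 1)) := by
          rw [hL, ← Real.log_mul (by positivity) (by positivity)]
          congr 1
          field_simp
        have h3 : 1 - ((i : ℝ) / (i - 1))⁻¹ = 1 / i := by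
          field_simp
          ring
        rw [h3] at h
        rw [h2, div_mul_eq_mul_div]
        gcongr
        calc (i : ℝ) * L + 1 = i * (L + 1 / i) := by field_simp
          _ ≤ _ := by gcongr
  refine ⟨V, ?_, ?_, fun i hi => (hboth i hi).1, fun i hi => (hboth i hi).2⟩
  · simp only [hVdef, Nat.cast_zero]
    rw [if_pos (by linarith)]
  · intro i hi
    simp only [hVdef]
    split_ifs with h
    · positivity
    · have hy : 0 < (i : ℝ) - 1 := lt_of_lt_of_le hbE (not_lt.1 h)
      have : (i : ℝ) ≤ n := by exact_mod_cast hi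
      exact mul_nonneg (by positivity) (hpos _ hy (by rw [hb]; linarith))

/-! ### An algorithm run against the weights. -/

namespace SecretaryAlgorithm

variable (a : SecretaryAlgorithm)

theorem acceptProb_nonneg {n : ℕ} (v : Fin n → ℝ) (i : Fin n) : 0 ≤ a.acceptProb v i :=
  (a i _).2.1

theorem acceptProb_le_one {n : ℕ} (v : Fin n → ℝ) (i : Fin n) : a.acceptProb v i ≤ 1 :=
  (a i _).2.2

/-- The probability that `a` rejects all of `v 0, …, v (n - 1)`. -/
def surviveProb {n : ℕ} (v : Fin n → ℝ) : ℝ :=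
  ∏ j, (1 - a.acceptProb v j)

theorem surviveProb_nonneg {n : ℕ} (v : Fin n → ℝ) : 0 ≤ a.surviveProb v :=
  prod_nonneg fun j _ => sub_nonneg.2 (a.acceptProb_le_one v j)

theorem stopProb_nonneg {n : ℕ} (v : Fin n → ℝ) (i : Fin n) : 0 ≤ a.stopProb v i :=
  mul_nonneg (prod_nonneg fun j _ => sub_nonneg.2 (a.acceptProb_le_one v j))
    (a.acceptProb_nonneg v i)

theorem acceptProb_snoc_castSucc {n : ℕ} (v : Fin n → ℝ) (y : ℝ) (i : Fin n) :
    a.acceptProb (Fin.snoc v y : Fin (n + 1) → ℝ) i.castSucc = a.acceptProb v i := by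
  unfold acceptProb
  have : (fun j : Fin (i + 1) => (Fin.snoc v y : Fin (n + 1) → ℝ)
      (Fin.castLE i.castSucc.isLt j)) = fun j => v (Fin.castLE i.isLt j) := by
    funext j
    exact Fin.snoc_castSucc (α := fun _ => ℝ) y v (Fin.castLE i.isLt j)
  exact congrArg (fun w => ((a i w : unitInterval) : ℝ)) this

theorem stopProb_castLE {k n : ℕ} (h : k ≤ n) (v : Fin n → ℝ) (i : Fin k) :
    a.stopProb v (i.castLE h) = a.stopProb (fun j => v (j.castLE h)) i := by
  unfold stopProb
  rw [filter_gt_eq_Iio, filter_gt_eq_Iio, Fin.prod_Iio_castLE]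
  rfl

theorem stopProb_snoc_last {n : ℕ} (v : Fin n → ℝ) (y : ℝ) :
    a.stopProb (Fin.snoc v y : Fin (n + 1) → ℝ) (Fin.last n) =
      a.surviveProb v * a.acceptProb (Fin.snoc v y : Fin (n + 1) → ℝ) (Fin.last n) := by
  unfold stopProb surviveProb
  rw [prod_filter, Fin.prod_univ_castSucc]
  simp [Fin.castSucc_lt_last, acceptProb_snoc_castSucc]

theorem surviveProb_snoc {n : ℕ} (v : Fin n → ℝ) (y : ℝ) :
    a.surviveProb (Fin.snoc v y : Fin (n + 1) → ℝ) =
      a.surviveProb v - a.stopProb (Fin.snoc v y : Fin (n + 1) → ℝ) (Fin.last n) := by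
  rw [stopProb_snoc_last]
  unfold surviveProb
  rw [Fin.prod_univ_castSucc]
  simp only [acceptProb_snoc_castSucc]
  ring

variable {N : ℕ} (φ : Fin N → ℝ)

/-- The weighted mass of prefixes of length `k` all of whose values are rejected. -/
noncomputable def surviveMass (k : ℕ) : ℝ :=
  ∑ u : Fin k → Fin N, prefixWeight u * a.surviveProb (φ ∘ u)

/-- The weighted mass of prefixes of length `k + 1` whose last value is a record and is accepted. -/
noncomputable def recordMass (k : ℕ) : ℝ :=
  ∑ v : Fin (k + 1) → Fin N, prefixWeight v *
    if ∀ j, v j ≤ v (Fin.last k) then a.stopProb (φ ∘ v) (Fin.last k) else 0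

theorem surviveMass_nonneg (k : ℕ) : 0 ≤ a.surviveMass φ k :=
  sum_nonneg fun _ _ => mul_nonneg (prefixWeight_nonneg _) (a.surviveProb_nonneg _)

theorem recordMass_nonneg (k : ℕ) : 0 ≤ a.recordMass φ k := by
  refine sum_nonneg fun _ _ => mul_nonneg (prefixWeight_nonneg _) ?_
  split_ifs
  exacts [a.stopProb_nonneg _ _, le_rfl]

theorem surviveMass_zero : a.surviveMass φ 0 = harmonicMass N := by
  simp [surviveMass, surviveProb, prefixWeight, Function.injective_of_subsingleton]

theorem surviveMass_succ_le (k : ℕ) :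
    a.surviveMass φ (k + 1) ≤ a.surviveMass φ k - a.recordMass φ k := by
  have h1 : a.recordMass φ k ≤
      ∑ v : Fin (k + 1) → Fin N, prefixWeight v * a.stopProb (φ ∘ v) (Fin.last k) := by
    refine sum_le_sum fun v _ => mul_le_mul_of_nonneg_left ?_ (prefixWeight_nonneg v)
    split_ifs
    exacts [le_rfl, a.stopProb_nonneg _ _]
  have h2 : a.surviveMass φ (k + 1) +
      ∑ v : Fin (k + 1) → Fin N, prefixWeight v * a.stopProb (φ ∘ v) (Fin.last k) ≤
      a.surviveMass φ k := by
    unfold surviveMass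
    rw [← sum_add_distrib, Fin.sum_pi_snoc]
    refine sum_le_sum fun u _ => ?_
    calc _ = (∑ x : Fin N, prefixWeight (Fin.snoc u x : Fin (k + 1) → Fin N)) *
          a.surviveProb (φ ∘ u) := by
          rw [sum_mul]
          refine sum_congr rfl fun x _ => ?_
          rw [Fin.comp_snoc, surviveProb_snoc]
          ring
      _ ≤ _ := mul_le_mul_of_nonneg_right (sum_prefixWeight_snoc u) (a.surviveProb_nonneg _)
  linarith

/-- Survival of `u` is decided before the next rank is seen, and records carry at most a 1/(k+1)
share of the weight of `u`. -/
theorem recordMass_le (k : ℕ) : ((k : ℝ) + 1) * a.recordMass φ k ≤ a.surviveMass φ k := by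
  have hk : (0 : ℝ) < (k : ℝ) + 1 := by positivity
  rw [← le_div_iff₀' hk]
  unfold recordMass surviveMass
  rw [Fin.sum_pi_snoc, sum_div]
  refine sum_le_sum fun u _ => ?_
  calc _ ≤ ∑ x : Fin N, (if topRank u ≤ (x : ℕ) then
          prefixWeight (Fin.snoc u x : Fin (k + 1) → Fin N) else 0) * a.surviveProb (φ ∘ u) := by
        refine sum_le_sum fun x _ => ?_
        have hs := a.surviveProb_nonneg (φ ∘ u)
        by_cases hx : topRank u ≤ (x : ℕ)
        · rw [if_pos hx]
          refine mul_le_mul_of_nonneg_left ?_ (prefixWeight_nonneg _)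
          split_ifs
          · rw [Fin.comp_snoc, stopProb_snoc_last]
            exact mul_le_of_le_one_right hs (a.acceptProb_le_one _ _)
          · exact hs
        · rw [if_neg hx, zero_mul]
          refine le_of_eq ?_
          split_ifs with hm
          swap
          · rw [mul_zero]
          have hle : ∀ j, u j ≤ x := fun j => by simpa using hm j.castSucc
          have : ¬ Function.Injective (Fin.snoc u x : Fin (k + 1) → Fin N) := by
            intro hi
            rw [Fin.snoc_injective_iff] at hi
            refine hx ((topRank_le_iff u _).2 fun j => ?_)
            exact lt_of_le_of_ne (hle j) fun he => hi.2 ⟨j, Fin.ext he⟩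
          rw [prefixWeight, if_neg this, zero_mul]
    _ ≤ 1 / ((k : ℝ) + 1) * prefixWeight u * a.surviveProb (φ ∘ u) := by
        rw [← sum_mul]
        exact mul_le_mul_of_nonneg_right (sum_prefixWeight_snoc_above u) (a.surviveProb_nonneg _)
    _ = _ := by ring

end SecretaryAlgorithm

/-- A record at time i remains the maximum only if each later rank falls below the top; the shares
k/(k+1) for i < k < n multiply to (i+1)/n. -/
theorem sum_prefixWeight_max_le {N i : ℕ} (G : (Fin (i + 1) → Fin N) → ℝ) (hG : ∀ u, 0 ≤ G u)
    (n : ℕ) (h : i + 1 ≤ n) :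
    ∑ v : Fin n → Fin N, prefixWeight v *
      (if ∀ j, v j ≤ v ((Fin.last i).castLE h) then G fun j => v (j.castLE h) else 0) ≤
    ((i : ℝ) + 1) / n *
      ∑ u, prefixWeight u * (if ∀ j, u j ≤ u (Fin.last i) then G u else 0) := by
  induction n, h using Nat.le_induction with
  | base =>
    rw [Nat.cast_add, Nat.cast_one, div_self (by positivity), one_mul]
    exact le_of_eq rfl
  | succ n h ih =>
    have hn : (0 : ℝ) < n := by exact_mod_cast (by omega : 0 < n)
    rw [Fin.sum_pi_snoc]
    have hstep : ∀ u : Fin n → Fin N, ∑ x : Fin N,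
        prefixWeight (Fin.snoc u x : Fin (n + 1) → Fin N) *
        (if ∀ j, (Fin.snoc u x : Fin (n + 1) → Fin N) j ≤
            (Fin.snoc u x : Fin (n + 1) → Fin N) ((Fin.last i).castLE (h.trans n.le_succ)) then
          G fun j => (Fin.snoc u x : Fin (n + 1) → Fin N) (j.castLE (h.trans n.le_succ)) else 0) ≤
        (n : ℝ) / (n + 1) * (prefixWeight u *
        (if ∀ j, u j ≤ u ((Fin.last i).castLE h) then G fun j => u (j.castLE h) else 0)) := by
      intro u
      set g := (if ∀ j, u j ≤ u ((Fin.last i).castLE h) then G fun j => u (j.castLE h) else 0)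
        with hg
      have hg0 : 0 ≤ g := by rw [hg]; split_ifs; exacts [hG _, le_rfl]
      have hpre : ∀ (x : Fin N) (j : Fin (i + 1)), (Fin.snoc u x : Fin (n + 1) → Fin N)
          (j.castLE (h.trans n.le_succ)) = u (j.castLE h) := fun x j =>
        Fin.snoc_castSucc (α := fun _ => Fin N) x u (j.castLE h)
      rw [← mul_assoc]
      refine le_trans ?_ (mul_le_mul_of_nonneg_right (sum_prefixWeight_snoc_below u) hg0)
      rw [sum_mul]
      refine sum_le_sum fun x _ => ?_
      simp only [hpre]
      split_ifs with h1 h2 h2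
      · refine mul_le_mul_of_nonneg_left ?_ (prefixWeight_nonneg _)
        rw [hg, if_pos fun j => by simpa using h1 j.castSucc]
      · exfalso
        have := h1 (Fin.last n)
        rw [Fin.snoc_last] at this
        exact h2 (lt_of_le_of_lt this (lt_topRank u _))
      · rw [mul_zero]
        exact mul_nonneg (prefixWeight_nonneg _) hg0
      · simp
    refine le_trans (sum_le_sum fun u _ => hstep u) ?_
    rw [← mul_sum]
    refine le_trans (mul_le_mul_of_nonneg_left ih (by positivity)) (le_of_eq ?_)
    push_cast
    field_simp

theorem SecretaryAlgorithm.sum_chooseMaxProb_le (a : SecretaryAlgorithm) {N : ℕ} {φ : Fin N → ℝ}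
    (hφ : StrictMono φ) {n : ℕ} (hn : 2 ≤ n) :
    ∑ v : Fin n → Fin N, prefixWeight v * a.chooseMaxProb (φ ∘ v) ≤
      (1 / Real.exp 1 + 1 / n) * harmonicMass N := by
  obtain ⟨V, hV0, hV, hmono, hdec⟩ := exists_potential hn
  have h := sum_le_of_potential (a.surviveMass φ) (a.recordMass φ) V (a.surviveMass_nonneg φ)
    (a.recordMass_nonneg φ) (a.surviveMass_succ_le φ) (a.recordMass_le φ) hV hmono hdec
  rw [hV0, surviveMass_zero] at h
  refine le_trans ?_ h
  rw [← Fin.sum_univ_eq_sum_range (fun i => ((i : ℝ) + 1) / n * a.recordMass φ i)]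
  unfold chooseMaxProb
  simp only [mul_sum]
  rw [sum_comm]
  refine sum_le_sum fun i _ => ?_
  have hi : (i : ℕ) + 1 ≤ n := i.isLt
  refine le_trans (le_of_eq ?_) (sum_prefixWeight_max_le
    (fun u => a.stopProb (φ ∘ u) (Fin.last i)) (fun u => a.stopProb_nonneg _ _) n hi)
  refine sum_congr rfl fun v _ => ?_
  have hc : (Fin.last (i : ℕ)).castLE hi = i := rfl
  rw [hc]
  simp only [Function.comp_apply, hφ.le_iff_le]
  have := a.stopProb_castLE hi (φ ∘ v) (Fin.last i)
  rw [hc] at this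
  rw [this]
  rfl

/-! ### From weights on tuples to a distribution on instances. -/

theorem sum_equiv_eq_sum_image_eq {N : ℕ} {φ : Fin N → ℝ} (hφ : Function.Injective φ)
    {I : Finset ℝ} (hI : I ⊆ univ.image φ) (F : (Fin I.card → ℝ) → ℝ) :
    ∑ σ : Fin I.card ≃ I, F (fun i => (σ i : ℝ)) =
      ∑ v : Fin I.card → Fin N with univ.image (φ ∘ v) = I, F (φ ∘ v) := by
  have hmem : ∀ x : I, ∃ k, φ k = x := fun x => by
    simpa using hI x.2
  choose r hr using hmem
  refine sum_bij (fun σ _ i => r (σ i)) ?_ ?_ ?_ ?_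
  · intro σ _
    rw [mem_filter]
    refine ⟨mem_univ _, ?_⟩
    ext y
    simp only [mem_image, mem_univ, true_and, Function.comp_apply, hr]
    exact ⟨fun ⟨i, hi⟩ => hi ▸ (σ i).2, fun hy => ⟨σ.symm ⟨y, hy⟩, by simp⟩⟩
  · intro σ _ τ _ h
    ext i
    have := congrArg φ (congrFun h i)
    simpa only [hr] using this
  · intro v hv
    have hv' := (mem_filter.1 hv).2
    have hm : ∀ i, φ (v i) ∈ I := fun i => by
      have : (φ ∘ v) i ∈ univ.image (φ ∘ v) := mem_image_of_mem _ (mem_univ i)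
      rw [hv'] at this
      exact this
    have hsurj : Function.Surjective fun i => (⟨φ (v i), hm i⟩ : I) := by
      rintro ⟨y, hy⟩
      have hy' := hy
      rw [← hv'] at hy'
      obtain ⟨i, -, hi⟩ := mem_image.1 hy'
      exact ⟨i, Subtype.ext hi⟩
    have hbij : Function.Bijective fun i => (⟨φ (v i), hm i⟩ : I) :=
      (Fintype.bijective_iff_surjective_and_card _).2 ⟨hsurj, by simp⟩
    refine ⟨Equiv.ofBijective _ hbij, mem_univ _, ?_⟩
    funext i
    exact hφ (by rw [hr]; rfl)
  · intro σ _
    congr 1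
    funext i
    simp [hr]

/-- The weight of the instance `I`, summed over all its arrival orders. -/
noncomputable def instanceWeight {N : ℕ} (φ : Fin N → ℝ) (n : ℕ) (I : Finset ℝ) : ℝ :=
  ∑ v : Fin n → Fin N with univ.image (φ ∘ v) = I, prefixWeight v

theorem instanceWeight_nonneg {N : ℕ} (φ : Fin N → ℝ) (n : ℕ) (I : Finset ℝ) :
    0 ≤ instanceWeight φ n I :=
  sum_nonneg fun _ _ => prefixWeight_nonneg _

theorem sum_powersetCard_fiber {N : ℕ} {φ : Fin N → ℝ} (hφ : Function.Injective φ) (n : ℕ)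
    (F : (Fin n → Fin N) → ℝ) :
    ∑ I ∈ (univ.image φ).powersetCard n,
      ∑ v : Fin n → Fin N with univ.image (φ ∘ v) = I, prefixWeight v * F v =
      ∑ v : Fin n → Fin N, prefixWeight v * F v := by
  simp only [sum_filter]
  rw [sum_comm]
  refine sum_congr rfl fun v _ => ?_
  rw [sum_ite_eq]
  refine ite_eq_left_iff.2 fun h => ?_
  have : ¬ Function.Injective v := by
    intro hv
    refine h (mem_powersetCard.2 ⟨?_, ?_⟩)
    · intro y hy
      obtain ⟨j, -, rfl⟩ := mem_image.1 hy
      exact mem_image_of_mem _ (mem_univ _)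
    · rw [card_image_of_injective _ (hφ.comp hv), card_univ, Fintype.card_fin]
  rw [prefixWeight, if_neg this, zero_mul]

/-- All orders of `I` have the same weight, so conditioning on `I` makes the arrival order uniform.
-/
theorem instanceWeight_mul_successProb (a : SecretaryAlgorithm) {N : ℕ} {φ : Fin N → ℝ}
    (hφ : Function.Injective φ) {n : ℕ} {I : Finset ℝ} (hI : I ∈ (univ.image φ).powersetCard n) :
    instanceWeight φ n I * a.successProb I =
      ∑ v : Fin n → Fin N with univ.image (φ ∘ v) = I,
        prefixWeight v * a.chooseMaxProb (φ ∘ v) := by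
  obtain ⟨hsub, rfl⟩ := mem_powersetCard.1 hI
  have hF := sum_equiv_eq_sum_image_eq hφ hsub a.chooseMaxProb
  have hone := sum_equiv_eq_sum_image_eq hφ hsub fun _ => 1
  rw [sum_const, sum_const, nsmul_one, nsmul_one, card_univ] at hone
  have hcard : (0 : ℝ) < (Fintype.card (Fin I.card ≃ I) : ℝ) := by
    have : Nonempty (Fin I.card ≃ I) := ⟨I.equivFin.symm⟩
    exact_mod_cast Fintype.card_pos
  set Φ : Finset (Fin I.card → Fin N) := univ.filter fun v => univ.image (φ ∘ v) = I with hΦ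
  have hconst : ∃ w, ∀ v ∈ Φ, prefixWeight v = w := by
    have hne : Φ.Nonempty := card_pos.1 (by rw [hone] at hcard; exact_mod_cast hcard)
    obtain ⟨v₀, hv₀⟩ := hne
    refine ⟨prefixWeight v₀, fun v hv => prefixWeight_eq_of_image_eq ?_⟩
    refine image_injective hφ ?_
    rw [image_image, image_image, (mem_filter.1 hv).2, (mem_filter.1 hv₀).2]
  obtain ⟨w, hw⟩ := hconst
  have hR : ∑ v ∈ Φ, prefixWeight v * a.chooseMaxProb (φ ∘ v) =
      w * ∑ v ∈ Φ, a.chooseMaxProb (φ ∘ v) := by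
    rw [mul_sum]
    exact sum_congr rfl fun v hv => by rw [hw v hv]
  rw [SecretaryAlgorithm.successProb, hF, instanceWeight, ← hΦ, sum_congr rfl hw, sum_const,
    nsmul_eq_mul, hone, hR]
  rw [hone] at hcard
  field_simp

/-- Any finite set of sufficiently many real numbers carries a hard distribution. -/
theorem exists_hard_distribution {N : ℕ} {φ : Fin N → ℝ} (hφ : StrictMono φ) {n : ℕ} (hn : 2 ≤ n)
    {c : ℝ} (hZ : 0 < ∑ v : Fin n → Fin N, prefixWeight v)
    (hc : (1 / Real.exp 1 + 1 / n) * harmonicMass N ≤ c * ∑ v : Fin n → Fin N, prefixWeight v) :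
    ∃ D : PMF ((univ.image φ).powersetCard n), ∀ a : SecretaryAlgorithm,
      ∑ I : (univ.image φ).powersetCard n, (D I).toReal * a.successProb (I : Finset ℝ) ≤ c := by
  set Z := ∑ v : Fin n → Fin N, prefixWeight v with hZdef
  have hnn : ∀ I, 0 ≤ instanceWeight φ n I / Z := fun I =>
    div_nonneg (instanceWeight_nonneg φ n I) hZ.le
  have hsum : ∑ I : (univ.image φ).powersetCard n, instanceWeight φ n I / Z = 1 := by
    rw [sum_coe_sort _ fun I => instanceWeight φ n I / Z, ← sum_div]
    have := sum_powersetCard_fiber hφ.injective n fun _ => 1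
    simp only [mul_one] at this
    unfold instanceWeight
    rw [this, div_self hZ.ne']
  refine ⟨PMF.ofFintype (fun I => ENNReal.ofReal (instanceWeight φ n I / Z)) ?_, fun a => ?_⟩
  · rw [← ENNReal.ofReal_sum_of_nonneg fun (I : (univ.image φ).powersetCard n) _ => hnn I, hsum, ENNReal.ofReal_one]
  · simp only [PMF.ofFintype_apply, ENNReal.toReal_ofReal (hnn _)]
    rw [sum_coe_sort _ fun I => instanceWeight φ n I / Z * a.successProb I]
    have : ∑ I ∈ (univ.image φ).powersetCard n, instanceWeight φ n I / Z * a.successProb I =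
        (∑ v : Fin n → Fin N, prefixWeight v * a.chooseMaxProb (φ ∘ v)) / Z := by
      rw [← sum_powersetCard_fiber hφ.injective, sum_div]
      refine sum_congr rfl fun I hI => ?_
      rw [← instanceWeight_mul_successProb a hφ.injective hI]
      ring
    rw [this, div_le_iff₀ hZ]
    exact (a.sum_chooseMaxProb_le hφ hn).trans hc

theorem mainTheorem5 (ε : ℝ) (hε : 0 < ε) (ρ : ℝ) (hρ : 1 < ρ) :
    ∃ (n : ℕ) (W : Finset ℝ) (D : PMF (W.powersetCard n)),
      1 ≤ n ∧
      (W : Set ℝ) ⊆ Set.range (fun k : ℕ => ρ ^ k) ∧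
      ∀ a : SecretaryAlgorithm,
        ∑ I : W.powersetCard n, (D I).toReal * a.successProb (I : Finset ℝ)
          ≤ 1 / Real.exp 1 + ε := by
  obtain ⟨m, hm⟩ := exists_nat_ge (2 / ε)
  set n := m + 2 with hn
  -- The first bound makes the total mass positive. The second is (1/e + ε) n ≤ (ε/2) H_N, which
  -- with 1/n ≤ ε/2 gives (1/e + 1/n) H_N ≤ (1/e + ε)(H_N - n).
  obtain ⟨N, hN⟩ := (Real.tendsto_sum_range_one_div_nat_succ_atTop.eventually_ge_atTop
    (max ((n : ℝ) + 1) ((1 / Real.exp 1 + ε) * n / (ε / 2)))).exists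
  have hN1 : (n : ℝ) + 1 ≤ harmonicMass N := (le_max_left _ _).trans hN
  have hN2 : (1 / Real.exp 1 + ε) * n / (ε / 2) ≤ harmonicMass N := (le_max_right _ _).trans hN
  have hmass : harmonicMass N - n ≤ ∑ v : Fin n → Fin N, prefixWeight v := by
    have := harmonicMass_sub_le_sum_prefixWeight N (m + 1)
    refine le_trans ?_ this
    rw [hn]
    push_cast
    linarith
  have hinv : 1 / (n : ℝ) ≤ ε / 2 := by
    have h1 : 2 / ε ≤ n := hm.trans (by rw [hn]; push_cast; linarith)
    have h0 : (0 : ℝ) < n := by rw [hn]; positivity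
    rw [div_le_iff₀ hε] at h1
    rw [div_le_iff₀ h0]
    linarith
  have hφ : StrictMono fun k : Fin N => ρ ^ (k : ℕ) := fun i j h => pow_lt_pow_right₀ hρ h
  have hE : 0 < 1 / Real.exp 1 := by positivity
  obtain ⟨D, hD⟩ := exists_hard_distribution hφ (n := n) (c := 1 / Real.exp 1 + ε) (by omega)
    (by linarith) (by
      rw [div_le_iff₀ (by positivity)] at hN2
      have h1 := mul_le_mul_of_nonneg_left hmass (add_pos hE hε).le
      have h2 := mul_le_mul_of_nonneg_right hinv (harmonicMass_nonneg N)
      linarith)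
  refine ⟨n, _, D, by omega, ?_, hD⟩
  intro x hx
  obtain ⟨k, -, rfl⟩ := mem_image.1 (mem_coe.1 hx)
  exact ⟨k, rfl⟩
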